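/- Let $R$ be an arbitrary (associative, unital) ring and $M$ an $R$-module whose cardinality $|M|$ is not $\omega$-measurable, i.e. there is no measurable cardinal $\kappa\le|M|$ (an uncountable cardinal $\kappa$ is measurable if there is a nonprincipal $\kappa$-complete ultrafilter on $\kappa$). For a set $I$, let $M^{I}$ be the direct power and $M^{(I)}$ the direct sum of $I$ copies of $M$. Let $\mathrm{Add}(M)$, respectively $\mathrm{Prod}(M)$, be the class of all $R$-modules isomorphic to a direct summand of $M^{(I)}$, respectively of $M^{I}$, for some set $I$. Then $$\mathrm{Add}(M)\subseteq \mathrm{Prod}(M)\iff M \text{ is } \Sigma\text{-algebraically compact}.$$ Here $M$ is $\Sigma$-algebraically compact if $M^{(I)}$ is algebraically compact for every infinite set $I$. A module $A$ is algebraically compact (pure-injective) if, whenever $A$ is a pure submodule of a module $N$, there is a homomorphism $\pi:N\to A$ with $\pi|_A=\mathrm{id}_A$. A submodule $A\subseteq N$ is pure if every finite system of $R$-linear equations with constants from $A$ that is solvable in $N$ is solvable in $A$. -/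

import Mathlib

universe u v w

namespace PureModules

/-- A positive-primitive formula in `n` free variables over `R`, in matrix form: the formula
`∃ y, A x + B y = 0`, where `x` has `n` entries, `y` has `numBound` entries and there are `numEq`
linear equations. -/
structure PPFormula (R : Type u) [Ring R] (n : ℕ) where
  /-- the number of existentially quantified variables -/
  numBound : ℕ
  /-- the number of linear equations -/
  numEq : ℕ
  /-- the coefficients of the free variables -/
  freeCoeff : Matrix (Fin numEq) (Fin n) R
  /-- the coefficients of the bound variables -/
  boundCoeff : Matrix (Fin numEq) (Fin numBound) R

/-- `ψ.Realize x` is `M ⊨ ψ(x)`. -/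
def PPFormula.Realize {R : Type u} [Ring R] {n : ℕ} (ψ : PPFormula R n)
    {M : Type v} [AddCommGroup M] [Module R M] (x : Fin n → M) : Prop :=
  ∃ y : Fin ψ.numBound → M, ∀ i : Fin ψ.numEq,
    ∑ j, ψ.freeCoeff i j • x j + ∑ k, ψ.boundCoeff i k • y k = 0

/-- A linear map `f : M → N` is a pure embedding: it identifies `M` with a submodule of `N` such
that `ψ(M) = Mⁿ ∩ ψ(N)` for every pp-formula `ψ` in any finite number `n` of free variables. -/
def IsPureEmbedding {R : Type u} [Ring R] {M : Type v} {N : Type w} [AddCommGroup M] [Module R M]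
    [AddCommGroup N] [Module R N] (f : M →ₗ[R] N) : Prop :=
  Function.Injective f ∧
    ∀ (n : ℕ) (ψ : PPFormula R n) (x : Fin n → M),
      ψ.Realize x ↔ ψ.Realize (fun j => f (x j))

/-- `M` is algebraically compact (pure-injective): whenever `M` is pure in a module `N`,
it splits. -/
def IsAlgebraicallyCompact (R : Type u) [Ring R] (M : Type v) [AddCommGroup M] [Module R M] :
    Prop :=
  ∀ (N : Type (max u v)) [AddCommGroup N] [Module R N] (f : M →ₗ[R] N),
    IsPureEmbedding f → ∃ p : N →ₗ[R] M, p ∘ₗ f = LinearMap.id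

/-- `M` is `Σ`-algebraically compact: `M^(I)` is algebraically compact for every infinite set
`I`. -/
def IsSigmaAlgebraicallyCompact (R : Type u) [Ring R] (M : Type v) [AddCommGroup M] [Module R M] :
    Prop :=
  ∀ (I : Type (max u v)) [Infinite I], IsAlgebraicallyCompact R (I →₀ M)

/-- `N` is isomorphic to a direct summand of `P`. -/
def IsIsoToDirectSummand (R : Type u) [Ring R] (N : Type v) (P : Type w) [AddCommGroup N]
    [Module R N] [AddCommGroup P] [Module R P] : Prop :=
  ∃ K : Submodule R P, IsComplemented K ∧ Nonempty (N ≃ₗ[R] K)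

/-- `Add(M)`: the class of all modules isomorphic to direct summands of direct sums `M^(I)` of
copies of `M`, with `I` an arbitrary set. -/
def Add (R : Type u) [Ring R] (M : Type v) [AddCommGroup M] [Module R M] :
    Set (ModuleCat.{max u v} R) :=
  {N | ∃ I : Type (max u v), IsIsoToDirectSummand R N (I →₀ M)}

/-- `Prod(M)`: the class of all modules isomorphic to direct summands of direct powers `M^I`,
with `I` an arbitrary set. -/
def Prod (R : Type u) [Ring R] (M : Type v) [AddCommGroup M] [Module R M] :
    Set (ModuleCat.{max u v} R) :=
  {N | ∃ I : Type (max u v), IsIsoToDirectSummand R N (I → M)}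

/-- `κ` is a measurable cardinal: it is uncountable and there is a nonprincipal `κ`-complete
ultrafilter on a set of cardinality `κ`. The class `CardinalInterFilter` says that intersections
of fewer than `κ` members are members. -/
def IsMeasurableCardinal (κ : Cardinal.{u}) : Prop :=
  Cardinal.aleph0 < κ ∧
    ∃ (X : Type u) (U : Ultrafilter X), Cardinal.mk X = κ ∧
      CardinalInterFilter (U : Filter X) κ ∧ ∀ a : X, ({a} : Set X) ∉ U

/-- A cardinal is `ω`-measurable if it is greater than or equal to the first measurable cardinal,
that is, to some measurable cardinal. -/
def IsOmegaMeasurable (c : Cardinal.{u}) : Prop :=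
  ∃ κ : Cardinal.{u}, IsMeasurableCardinal κ ∧ κ ≤ c

end PureModules

/-! Both conditions are linked through the descending chain condition on pp-definable subgroups of
`M`. A direct sum is pure in the corresponding direct power, so if `M^(I)` is algebraically compact
it is a summand of `M^I`; this gives `Add ⊆ Prod`.

Conversely, let `H 0 > H 1 > ...` be pp-definable subgroups of `M`, let `Λ` have more than `|M| +
ℵ₀` elements, and let `p : M^I → M^(Λ)` be a retraction. A form of Chase's lemma
(`isCardinalBoundedOn_univ`) gives `n` and a set `J` of at most `|M| + ℵ₀` coordinates such that `p`
maps `(H n)^I` into `⋂ H m` at every coordinate outside `J`. Applied to the copy of `H n` at some `j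
∉ J`, this forces `H n ≤ H (n + 1)`. So the chain condition holds; it passes to every `M^(I)`, and
there it makes pp-types realizable (`PreservesSolvability.exists_insert`), so that Zorn's lemma
splits all pure embeddings.

The cardinality hypothesis enters Chase's lemma as follows. The sets on which `p` is bounded by
finitely many coordinates form an ideal closed under countable unions. Where this ideal is prime, it
gives a countably complete ultrafilter, whose images on `M` are principal: families are constant up
to the ideal, and there are only `|M|` constants. Where it is not prime one keeps splitting, and
Chase's lemma forbids splitting infinitely often. -/

namespace PureModules

/-! ### Countably complete ultrafilters and measurable cardinals -/

section Measurable

/-- On a set whose cardinality is not `ω`-measurable, countably complete ultrafilters are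
principal. -/
theorem exists_singleton_mem_of_not_isOmegaMeasurable {M : Type v}
    (hM : ¬ IsOmegaMeasurable (Cardinal.mk M)) (V : Ultrafilter M)
    (hV : CountableInterFilter (V : Filter M)) : ∃ c : M, ({c} : Set M) ∈ V := by
  by_contra! hne
  let S : Set Cardinal.{v} := {κ | ∃ (X : Type v) (U : Ultrafilter X), Cardinal.mk X = κ ∧
    CountableInterFilter (U : Filter X) ∧ ∀ a : X, ({a} : Set X) ∉ U}
  have hS : Cardinal.mk M ∈ S := ⟨M, V, rfl, hV, hne⟩
  -- The least cardinal carrying a nonprincipal countably complete ultrafilter is measurable.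
  obtain ⟨κ, ⟨X, U, hX, hU, hUne⟩, hmin⟩ := WellFounded.has_min Cardinal.lt_wf S ⟨_, hS⟩
  refine hM ⟨κ, ⟨?_, X, U, hX, ⟨?_⟩, hUne⟩, not_lt.1 (hmin _ hS)⟩
  · by_contra! hκ
    have : Countable X := Cardinal.mk_le_aleph0_iff.1 (hX.trans_le hκ)
    have h : (⋂ a : X, ({a} : Set X)ᶜ) ∈ (U : Filter X) :=
      countable_iInter_mem.2 fun a => Ultrafilter.compl_mem_iff_notMem.2 (hUne a)
    have h0 : (⋂ a : X, ({a} : Set X)ᶜ) = ∅ := by ext x; simp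
    rw [h0] at h
    exact U.empty_notMem h
  · intro T hT hTU
    by_contra hInter
    have hc : (⋂₀ T)ᶜ ∈ U := Ultrafilter.compl_mem_iff_notMem.2 hInter
    obtain ⟨s₀, hs₀⟩ : T.Nonempty := by
      rw [Set.nonempty_iff_ne_empty]
      rintro rfl
      exact hInter (by simp)
    -- If fewer than `κ` members of `U` had intersection outside `U`, sending almost every `x` to a
    -- member of `T` that omits it would push `U` to a nonprincipal countably complete ultrafilter
    -- on `T`, against the minimality of `κ`.
    have hg : ∀ x : X, ∃ s : T, x ∉ ⋂₀ T → x ∉ (s : Set X) := by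
      intro x
      by_cases hx : x ∈ ⋂₀ T
      · exact ⟨⟨s₀, hs₀⟩, fun h => absurd hx h⟩
      · have hx' := hx
        simp only [Set.mem_sInter, not_forall] at hx'
        obtain ⟨s, hs, hxs⟩ := hx'
        exact ⟨⟨s, hs⟩, fun _ => hxs⟩
    choose g hg using hg
    refine hmin (Cardinal.mk T) ⟨T, U.map g, rfl, ?_, fun s hs => ?_⟩ hT
    · rw [Ultrafilter.coe_map]
      infer_instance
    · have hs' : g ⁻¹' {s} ∈ U := hs
      have h := Filter.inter_mem (Filter.inter_mem hs' hc) (hTU s s.2)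
      obtain ⟨x, ⟨hx1, hx2⟩, hx3⟩ := U.nonempty_of_mem h
      exact hg x hx2 ((congrArg Subtype.val hx1) ▸ hx3)

end Measurable

/-! ### Chase's lemma and boundedness of maps from powers to direct sums -/

section Chase

variable {I Λ M : Type*} [AddCommGroup M]

/-- `f` sends the families in `H n` supported on `X`, outside of the coordinates in `J`, to
families in the intersection of all `H m`. -/
def IsBoundedOn (H : ℕ → AddSubgroup M) (f : (I → M) →+ (Λ →₀ M)) (n : ℕ) (J : Set Λ)
    (X : Set I) : Prop :=
  ∀ a : I → M, (∀ i, a i ∈ H n) → (∀ i, i ∉ X → a i = 0) → ∀ j, j ∉ J → ∀ m, f a j ∈ H m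

/-- `f` is bounded on `X` by finitely many coordinates. -/
def IsFinitelyBoundedOn (H : ℕ → AddSubgroup M) (f : (I → M) →+ (Λ →₀ M)) (X : Set I) : Prop :=
  ∃ (n : ℕ) (F : Finset Λ), IsBoundedOn H f n F X

/-- `f` is bounded on `X` by at most `κ` coordinates. -/
def IsCardinalBoundedOn (H : ℕ → AddSubgroup M) (f : (I → M) →+ (Λ →₀ M)) (κ : Cardinal)
    (X : Set I) : Prop :=
  ∃ (n : ℕ) (J : Set Λ), Cardinal.mk J ≤ κ ∧ IsBoundedOn H f n J X

variable {H : ℕ → AddSubgroup M} {f : (I → M) →+ (Λ →₀ M)}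

theorem IsBoundedOn.mono {n : ℕ} {J : Set Λ} {X Y : Set I} (h : IsBoundedOn H f n J X)
    (hYX : Y ⊆ X) : IsBoundedOn H f n J Y :=
  fun a ha haY => h a ha fun i hi => haY i fun hY => hi (hYX hY)

theorem IsBoundedOn.union (hH : Antitone H) {n n' : ℕ} {J J' : Set Λ} {X X' : Set I}
    (h : IsBoundedOn H f n J X) (h' : IsBoundedOn H f n' J' X') :
    IsBoundedOn H f (max n n') (J ∪ J') (X ∪ X') := by
  classical
  intro a ha haX j hj m
  have hsum : a = (fun i => if i ∈ X then a i else 0) + fun i => if i ∈ X then 0 else a i := by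
    ext i
    by_cases hi : i ∈ X <;> simp [hi]
  rw [hsum, map_add, Finsupp.add_apply]
  refine add_mem (h _ (fun i => ?_) (fun i hi => by simp [hi]) j (fun hJ => hj (.inl hJ)) m)
    (h' _ (fun i => ?_) (fun i hi => ?_) j (fun hJ => hj (.inr hJ)) m)
  · by_cases hi : i ∈ X
    · simpa [hi] using hH (le_max_left n n') (ha i)
    · simp [hi, zero_mem]
  · by_cases hi : i ∈ X
    · simp [hi, zero_mem]
    · simpa [hi] using hH (le_max_right n n') (ha i)
  · by_cases hX : i ∈ X
    · simp [hX]
    · simpa [hX] using haX i (by simp [hX, hi])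

theorem IsFinitelyBoundedOn.mono {X Y : Set I} (h : IsFinitelyBoundedOn H f X) (hYX : Y ⊆ X) :
    IsFinitelyBoundedOn H f Y := by
  obtain ⟨n, F, h⟩ := h
  exact ⟨n, F, h.mono hYX⟩

theorem IsFinitelyBoundedOn.union (hH : Antitone H) {X Y : Set I}
    (hX : IsFinitelyBoundedOn H f X) (hY : IsFinitelyBoundedOn H f Y) :
    IsFinitelyBoundedOn H f (X ∪ Y) := by
  classical
  obtain ⟨n, F, h⟩ := hX
  obtain ⟨n', F', h'⟩ := hY
  refine ⟨max n n', F ∪ F', ?_⟩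
  rw [Finset.coe_union]
  exact h.union hH h'

theorem IsFinitelyBoundedOn.isCardinalBoundedOn {κ : Cardinal} (hκ : Cardinal.aleph0 ≤ κ)
    {X : Set I} (h : IsFinitelyBoundedOn H f X) : IsCardinalBoundedOn H f κ X := by
  obtain ⟨n, F, h⟩ := h
  exact ⟨n, F, ((Cardinal.lt_aleph0_of_finite _).le).trans hκ, h⟩

theorem IsCardinalBoundedOn.union (hH : Antitone H) {κ : Cardinal} (hκ : Cardinal.aleph0 ≤ κ)
    {X Y : Set I} (hX : IsCardinalBoundedOn H f κ X) (hY : IsCardinalBoundedOn H f κ Y) :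
    IsCardinalBoundedOn H f κ (X ∪ Y) := by
  obtain ⟨n, J, hJ, h⟩ := hX
  obtain ⟨n', J', hJ', h'⟩ := hY
  exact ⟨max n n', J ∪ J',
    (Cardinal.mk_union_le J J').trans (Cardinal.add_le_of_le hκ hJ hJ'), h.union hH h'⟩

/-- Chase's lemma: if the sets `Y k` decrease to the empty set, then `f` is finitely bounded on
one of them. -/
theorem exists_isFinitelyBoundedOn_of_antitone (hH : Antitone H)
    (hf : ∀ n a, (∀ i, a i ∈ H n) → ∀ j, f a j ∈ H n) {Y : ℕ → Set I} (hY : Antitone Y)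
    (hY0 : ⋂ k, Y k = ∅) : ∃ m, IsFinitelyBoundedOn H f (Y m) := by
  classical
  by_contra! hbad
  -- Entries are `(n, a, j, m)`: a family `a` in `H n` supported on `Y n`, with `f a j ∉ H m`. Each
  -- new `n` exceeds the earlier `n` and is at least the earlier `m`, and the new `j` avoids the
  -- supports of the earlier `f a`.
  obtain ⟨s, hsP, hsr⟩ := exists_seq_of_forall_finset_exists
    (fun x : ℕ × (I → M) × Λ × ℕ => (∀ i, x.2.1 i ∈ H x.1) ∧ (∀ i, i ∉ Y x.1 → x.2.1 i = 0) ∧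
      f x.2.1 x.2.2.1 ∉ H x.2.2.2)
    (fun x y => x.1 < y.1 ∧ x.2.2.2 ≤ y.1 ∧ f x.2.1 y.2.2.1 = 0) (by
      intro s _
      let n := s.sup (fun x => max (x.1 + 1) x.2.2.2)
      have hn : ∀ x ∈ s, max (x.1 + 1) x.2.2.2 ≤ n := fun x hx =>
        Finset.le_sup (f := fun x : ℕ × (I → M) × Λ × ℕ => max (x.1 + 1) x.2.2.2) hx
      have h := hbad n
      simp only [IsFinitelyBoundedOn, IsBoundedOn, not_exists, not_forall] at h
      obtain ⟨a, ha, haY, j, hj, m, hm⟩ := h n (s.biUnion fun x => (f x.2.1).support)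
      refine ⟨(n, a, j, m), ⟨ha, haY, hm⟩, fun x hx => ⟨?_, ?_, ?_⟩⟩
      · exact (le_max_left _ _).trans (hn x hx)
      · exact (le_max_right _ _).trans (hn x hx)
      · by_contra h0
        exact hj (Finset.mem_coe.2 (Finset.mem_biUnion.2 ⟨x, hx, Finsupp.mem_support_iff.2 h0⟩)))
  let n : ℕ → ℕ := fun k => (s k).1
  let a : ℕ → I → M := fun k => (s k).2.1
  let j : ℕ → Λ := fun k => (s k).2.2.1
  let n' : ℕ → ℕ := fun k => (s k).2.2.2
  have ha : ∀ k i, a k i ∈ H (n k) := fun k => (hsP k).1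
  have haY : ∀ k i, i ∉ Y (n k) → a k i = 0 := fun k => (hsP k).2.1
  have hnot : ∀ k, f (a k) (j k) ∉ H (n' k) := fun k => (hsP k).2.2
  have hmono : StrictMono n := strictMono_nat_of_lt_succ fun k => (hsr k (k + 1) k.lt_succ_self).1
  have hzero : ∀ k l, k < l → f (a k) (j l) = 0 := fun k l h => (hsr k l h).2.2
  have hK : ∀ i, ∃ K, ∀ k, K ≤ k → a k i = 0 := by
    intro i
    have hi : i ∉ ⋂ k, Y k := by simp [hY0]
    simp only [Set.mem_iInter, not_forall] at hi
    obtain ⟨K, hK⟩ := hi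
    exact ⟨K, fun k hk => haY k i fun h => hK (hY (hk.trans hmono.le_apply) h)⟩
  choose K hK using hK
  -- `T m` is the infinite sum of the `a k` with `k ≥ m`, which is finite at each `i` because the
  -- sets `Y k` eventually omit `i`.
  let T : ℕ → I → M := fun m i => ∑ k ∈ Finset.Ico m (K i), a k i
  have hT : ∀ m, T m = a m + T (m + 1) := by
    intro m
    ext i
    by_cases hm : m < K i
    · simp [T, Finset.sum_eq_sum_Ico_succ_bot hm]
    · have h1 : K i ≤ m := not_lt.1 hm
      simp [T, hK i m h1, Finset.Ico_eq_empty_of_le h1,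
        Finset.Ico_eq_empty_of_le (h1.trans m.le_succ)]
  have hTmem : ∀ m i, T m i ∈ H (n m) := fun m i => sum_mem fun k hk =>
    hH (hmono.monotone (Finset.mem_Ico.1 hk).1) (ha k i)
  have hT0 : ∀ m, T 0 = ∑ k ∈ Finset.range m, a k + T m := by
    intro m
    induction m with
    | zero => simp
    | succ m ih => rw [ih, hT m, Finset.sum_range_succ, add_assoc]
  -- At `j m` the terms before `a m` contribute zero and the tail contributes an element of `H (n'
  -- m)`, so it cannot cancel `f (a m) (j m)`. Thus `f (T 0)` would have infinite support.
  have hne : ∀ m, j m ∈ (f (T 0)).support := by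
    intro m
    rw [Finsupp.mem_support_iff, hT0 m, hT m]
    have h0 : f (∑ k ∈ Finset.range m, a k) (j m) = 0 := by
      rw [map_sum, Finsupp.finsetSum_apply]
      exact Finset.sum_eq_zero fun k hk => hzero k m (Finset.mem_range.1 hk)
    rw [map_add, map_add, Finsupp.add_apply, Finsupp.add_apply, h0, zero_add]
    intro h
    apply hnot m
    rw [eq_neg_of_add_eq_zero_left h]
    exact neg_mem (hH (hsr m (m + 1) m.lt_succ_self).2.1 (hf _ _ (hTmem (m + 1)) (j m)))
  have hinj : Function.Injective j := by
    have key : ∀ k l, k < l → j k ≠ j l := by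
      intro k l hkl h
      apply hnot k
      rw [h, hzero k l hkl]
      exact zero_mem _
    intro k l h
    rcases lt_trichotomy k l with hkl | hkl | hkl
    · exact absurd h (key k l hkl)
    · exact hkl
    · exact absurd h.symm (key l k hkl)
  exact Set.infinite_of_injective_forall_mem hinj hne (f (T 0)).support.finite_toSet

/-- What remains of the union after removing `B 0, ..., B k` decreases to the empty set, so Chase's
lemma bounds `f` on some remainder; only finitely many `B k` are left to add. -/
theorem IsFinitelyBoundedOn.iUnion (hH : Antitone H)
    (hf : ∀ n a, (∀ i, a i ∈ H n) → ∀ j, f a j ∈ H n) {B : ℕ → Set I}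
    (hB : ∀ k, IsFinitelyBoundedOn H f (B k)) : IsFinitelyBoundedOn H f (⋃ k, B k) := by
  have hacc : ∀ k, IsFinitelyBoundedOn H f (Set.accumulate B k) := by
    intro k
    induction k with
    | zero => simpa using hB 0
    | succ k ih =>
      rw [Set.accumulate_succ]
      exact ih.union hH (hB _)
  obtain ⟨m, hm⟩ := exists_isFinitelyBoundedOn_of_antitone hH hf
    (Y := fun k => (⋃ k, B k) \ Set.accumulate B k)
    (fun k l h => Set.sdiff_subset_sdiff_right (Set.monotone_accumulate h)) (by
      rw [← Set.sdiff_iUnion, Set.iUnion_accumulate, Set.sdiff_self])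
  exact (hm.union hH (hacc m)).mono (by rw [Set.sdiff_union_self]; exact Set.subset_union_left)

/-- If the finitely bounded subsets of `X` form a prime ideal, then families in `M` are constant
on `X` up to a finitely bounded set, and `f` is bounded on `X` by at most `|M|` coordinates. -/
theorem isCardinalBoundedOn_of_prime {I : Type*} {Λ : Type w} {M : Type v} [AddCommGroup M]
    {H : ℕ → AddSubgroup M} {f : (I → M) →+ (Λ →₀ M)} (hH : Antitone H)
    (hf : ∀ n a, (∀ i, a i ∈ H n) → ∀ j, f a j ∈ H n)
    (hM : ¬ IsOmegaMeasurable (Cardinal.mk M)) {κ : Cardinal.{w}} (hκ : Cardinal.aleph0 ≤ κ)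
    (hMκ : Cardinal.lift.{w} (Cardinal.mk M) ≤ Cardinal.lift.{v} κ) {X : Set I}
    (hX : ∀ Y ⊆ X, IsFinitelyBoundedOn H f Y ∨ IsFinitelyBoundedOn H f (X \ Y)) :
    IsCardinalBoundedOn H f κ X := by
  classical
  by_cases hXgood : IsFinitelyBoundedOn H f X
  · exact hXgood.isCardinalBoundedOn hκ
  -- The filter dual to the ideal of finitely bounded subsets of `X`; primeness makes it an
  -- ultrafilter.
  let F : Filter I := Filter.ofCountableInter {A | IsFinitelyBoundedOn H f (X \ A)}
    (by
      intro S hS hSl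
      rcases S.eq_empty_or_nonempty with rfl | hne
      · simp only [Set.sInter_empty, Set.mem_ofPred_eq, Set.sdiff_univ]
        obtain h | h := hX ∅ (Set.empty_subset _)
        · exact h
        · exact absurd (by simpa using h) hXgood
      · obtain ⟨A, rfl⟩ := hS.exists_eq_range hne
        simp only [Set.mem_ofPred_eq, Set.sInter_range, Set.sdiff_iInter]
        exact IsFinitelyBoundedOn.iUnion hH hf fun k => hSl (Set.mem_range_self k))
    (fun A B hA hAB => IsFinitelyBoundedOn.mono hA (Set.sdiff_subset_sdiff_right hAB))
  have hF : ∀ A, A ∈ F ↔ IsFinitelyBoundedOn H f (X \ A) := fun A => Iff.rfl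
  let U : Ultrafilter I := Ultrafilter.ofComplNotMemIff F (by
    intro A
    rw [hF, hF, Set.sdiff_compl]
    constructor
    · intro h
      obtain h' | h' := hX (X ∩ A) Set.inter_subset_left
      · exact absurd h' h
      · simpa using h'
    · intro h h'
      exact hXgood ((h'.union hH h).mono (by rw [Set.inter_union_sdiff])))
  have hUF : (U : Filter I) = F := rfl
  have hU : CountableInterFilter (U : Filter I) := by
    rw [hUF]
    infer_instance
  have hconst : ∀ a : I → M, ∃ c, IsFinitelyBoundedOn H f (X \ a ⁻¹' {c}) := by
    intro a
    obtain ⟨c, hc⟩ := exists_singleton_mem_of_not_isOmegaMeasurable hM (U.map a) (by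
      rw [Ultrafilter.coe_map]
      infer_instance)
    exact ⟨c, hc⟩
  let e : M → I → M := fun c i => if i ∈ X then c else 0
  -- All coordinates reached by the constant families on `X`: at most `|M|` finite supports.
  let J : Set Λ := ⋃ c : M, ((f (e c)).support : Set Λ)
  have hJ : Cardinal.mk J ≤ κ := by
    have h1 : Cardinal.lift.{v} (Cardinal.mk J) ≤
        Cardinal.lift.{w} (Cardinal.mk M) * ⨆ c, Cardinal.lift.{v} (Cardinal.mk
          ((f (e c)).support : Set Λ)) := Cardinal.mk_iUnion_le_lift _
    have h2 : (⨆ c, Cardinal.lift.{v} (Cardinal.mk ((f (e c)).support : Set Λ))) ≤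
        Cardinal.lift.{v} κ := ciSup_le' fun c => Cardinal.lift_le.2
          (((Cardinal.lt_aleph0_of_finite _).le).trans hκ)
    have h3 := h1.trans (mul_le_mul' hMκ h2)
    rw [← Cardinal.lift_mul, Cardinal.lift_le, Cardinal.mul_eq_self hκ] at h3
    exact h3
  by_contra hbad
  -- Subtracting its almost-everywhere value turns a bad family into one supported on a finitely
  -- bounded set. Nothing changes at `j ∉ J`, so the new family is still bad there; the coordinates
  -- are chosen distinct.
  obtain ⟨s, hsP, hsr⟩ := exists_seq_of_forall_finset_exists
    (fun x : ℕ × (I → M) × Λ => (∀ i, x.2.1 i ∈ H x.1) ∧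
      (∃ B, IsFinitelyBoundedOn H f B ∧ ∀ i, i ∉ B → x.2.1 i = 0) ∧
      ∃ m, f x.2.1 x.2.2 ∉ H m)
    (fun x y => x.1 < y.1 ∧ x.2.2 ≠ y.2.2) (by
      intro s _
      let n := s.sup (fun x => x.1 + 1)
      have hn : ∀ x ∈ s, x.1 + 1 ≤ n := fun x hx =>
        Finset.le_sup (f := fun x : ℕ × (I → M) × Λ => x.1 + 1) hx
      simp only [IsCardinalBoundedOn, IsBoundedOn, not_exists, not_and, not_forall] at hbad
      obtain ⟨a, ha, haX, j, hj, m, hm⟩ := hbad n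
        (J ∪ (s.image (fun x : ℕ × (I → M) × Λ => x.2.2) : Finset Λ))
        ((Cardinal.mk_union_le _ _).trans (Cardinal.add_le_of_le hκ hJ
          (((Cardinal.lt_aleph0_of_finite _).le).trans hκ)))
      obtain ⟨c, hc⟩ := hconst a
      have hcH : c ∈ H n := by
        obtain ⟨i, hi⟩ : (X ∩ a ⁻¹' {c}).Nonempty := by
          rw [Set.nonempty_iff_ne_empty]
          intro h0
          apply hXgood
          rwa [← Set.sdiff_self_inter, h0, Set.sdiff_empty] at hc
        have hac : a i = c := hi.2
        exact hac ▸ ha i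
      have hej : f (e c) j = 0 := by
        by_contra h0
        exact hj (.inl (Set.mem_iUnion.2 ⟨c, Finset.mem_coe.2 (Finsupp.mem_support_iff.2 h0)⟩))
      refine ⟨(n, a - e c, j), ⟨fun i => ?_, ⟨_, hc, fun i hi => ?_⟩, m, ?_⟩,
        fun x hx => ⟨hn x hx, fun h => ?_⟩⟩
      · refine sub_mem (ha i) ?_
        by_cases hi : i ∈ X
        · simpa [e, hi] using hcH
        · simp [e, hi, zero_mem]
      · by_cases hiX : i ∈ X
        · have hac : a i = c := by
            by_contra h0
            exact hi ⟨hiX, h0⟩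
          simp [e, hiX, hac]
        · simp [e, hiX, haX i hiX]
      · simpa [map_sub, hej] using hm
      · exact hj (.inr (Finset.mem_coe.2 (Finset.mem_image.2 ⟨x, hx, h⟩))))
  choose hsH hsB hsm using hsP
  choose B hB hsB using hsB
  obtain ⟨n₀, F₀, h⟩ := IsFinitelyBoundedOn.iUnion hH hf hB
  have hmono : StrictMono fun k => (s k).1 :=
    strictMono_nat_of_lt_succ fun k => (hsr k (k + 1) k.lt_succ_self).1
  -- The first entries increase strictly, so from index `n₀` on all families lie in `H n₀`. The
  -- bound on the union of the supports then confines infinitely many distinct coordinates to the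
  -- finite set `F₀`.
  have hinj : Function.Injective fun k => (s (n₀ + k)).2.2 := by
    intro k l hkl
    rcases lt_trichotomy k l with h | h | h
    · exact absurd hkl (hsr _ _ (Nat.add_lt_add_left h n₀)).2
    · exact h
    · exact absurd hkl.symm (hsr _ _ (Nat.add_lt_add_left h n₀)).2
  refine Set.infinite_of_injective_forall_mem hinj (s := (F₀ : Set Λ)) (fun k => ?_)
    F₀.finite_toSet
  by_contra hk
  obtain ⟨m, hm⟩ := hsm (n₀ + k)
  refine hm (h _ (fun i => hH ?_ (hsH (n₀ + k) i)) (fun i hi => hsB (n₀ + k) i fun hB => ?_) _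
    hk m)
  · exact (Nat.le_add_right n₀ k).trans hmono.le_apply
  · exact hi (Set.mem_iUnion.2 ⟨_, hB⟩)

/-- A homomorphism from a power of `M` to a direct sum of copies of `M` which preserves a
descending chain of subgroups is bounded by at most `|M|` coordinates, provided that `|M|` is not
`ω`-measurable. -/
theorem isCardinalBoundedOn_univ {I : Type*} {Λ : Type w} {M : Type v} [AddCommGroup M]
    {H : ℕ → AddSubgroup M} {f : (I → M) →+ (Λ →₀ M)} (hH : Antitone H)
    (hf : ∀ n a, (∀ i, a i ∈ H n) → ∀ j, f a j ∈ H n)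
    (hM : ¬ IsOmegaMeasurable (Cardinal.mk M)) {κ : Cardinal.{w}} (hκ : Cardinal.aleph0 ≤ κ)
    (hMκ : Cardinal.lift.{w} (Cardinal.mk M) ≤ Cardinal.lift.{v} κ) :
    IsCardinalBoundedOn H f κ Set.univ := by
  by_contra hbad
  have hsplit : ∀ X : {X : Set I // ¬ IsCardinalBoundedOn H f κ X},
      ∃ Y : {X : Set I // ¬ IsCardinalBoundedOn H f κ X}, Y.1 ⊆ X.1 ∧
        ¬ IsFinitelyBoundedOn H f (X.1 \ Y.1) := by
    rintro ⟨X, hX⟩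
    by_contra! hno
    apply hX
    -- One of `Y` and `X \ Y` is not bounded by `κ` coordinates; as `X` cannot be split, the other
    -- is finitely bounded.
    refine isCardinalBoundedOn_of_prime hH hf hM hκ hMκ fun Y hY => ?_
    by_cases hYs : IsCardinalBoundedOn H f κ Y
    · left
      have h := hno ⟨X \ Y, fun h => hX ?_⟩ Set.sdiff_subset
      · simpa [Set.inter_eq_right.2 hY] using h
      · simpa [Set.union_eq_right.2 hY] using hYs.union hH hκ h
    · exact .inr (hno ⟨Y, hYs⟩ hY)
  choose g hgX hg using hsplit
  let Y : ℕ → {X : Set I // ¬ IsCardinalBoundedOn H f κ X} := fun k => g^[k] ⟨Set.univ, hbad⟩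
  have hY : ∀ k, Y (k + 1) = g (Y k) := fun k => Function.iterate_succ_apply' _ _ _
  have hanti : Antitone fun k => (Y k).1 := antitone_nat_of_succ_le fun k => by
    rw [hY]
    exact hgX _
  -- Removing the common intersection makes the sequence decrease to the empty set while keeping
  -- each difference `Y m \ Y (m + 1)`.
  obtain ⟨m, hm⟩ := exists_isFinitelyBoundedOn_of_antitone hH hf
    (Y := fun k => (Y k).1 \ ⋂ l, (Y l).1) (fun k l h => Set.sdiff_subset_sdiff_left (hanti h)) (by
      ext i
      simp only [Set.mem_iInter, Set.mem_sdiff, Set.mem_empty_iff_false, iff_false, not_forall]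
      by_contra! h
      obtain ⟨k, hk⟩ := (h 0).2
      exact hk (h k).1)
  refine hg (Y m) (hm.mono (Set.sdiff_subset_sdiff_right ?_))
  rw [← hY]
  exact Set.iInter_subset _ (m + 1)

end Chase


/-! ### Calculus of pp-conditions -/

section Systems

variable {R : Type u} [Ring R]

/-- The pp-condition `∃ y, C x + D y = 0` with coefficient matrices over arbitrary index types. -/
def IsSolvable {E J B : Type} [Fintype J] [Fintype B] (C : Matrix E J R) (D : Matrix E B R)
    {N : Type v} [AddCommGroup N] [Module R N] (x : J → N) : Prop :=
  ∃ y : B → N, ∀ e, ∑ j, C e j • x j + ∑ b, D e b • y b = 0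

theorem PPFormula.realize_iff_isSolvable {n : ℕ} (ψ : PPFormula R n) {N : Type v}
    [AddCommGroup N] [Module R N] (x : Fin n → N) :
    ψ.Realize x ↔ IsSolvable ψ.freeCoeff ψ.boundCoeff x :=
  Iff.rfl

/-- A pp-formula equivalent to the given finite pp-condition. -/
noncomputable def PPFormula.ofSystem {E J B : Type} [Fintype E] [Fintype B] (C : Matrix E J R)
    (D : Matrix E B R) {n : ℕ} (σ : Fin n ≃ J) : PPFormula R n where
  numBound := Fintype.card B
  numEq := Fintype.card E
  freeCoeff := C.submatrix (Fintype.equivFin E).symm σ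
  boundCoeff := D.submatrix (Fintype.equivFin E).symm (Fintype.equivFin B).symm

theorem PPFormula.realize_ofSystem {E J B : Type} [Fintype E] [Fintype J] [Fintype B]
    (C : Matrix E J R) (D : Matrix E B R) {n : ℕ} (σ : Fin n ≃ J) {N : Type v} [AddCommGroup N]
    [Module R N] (x : J → N) : (ofSystem C D σ).Realize (x ∘ σ) ↔ IsSolvable C D x := by
  let ε := (Fintype.equivFin E).symm
  let β := (Fintype.equivFin B).symm
  have key : ∀ (e : E) (y : B → N),
      ∑ j, C e (σ j) • x (σ j) + ∑ b, D e (β b) • y (β b) =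
        ∑ j, C e j • x j + ∑ b, D e b • y b := fun e y => by
    rw [σ.sum_comp (fun j => C e j • x j), β.sum_comp (fun b => D e b • y b)]
  constructor
  · rintro ⟨y, hy⟩
    change Fin (Fintype.card B) → N at y
    refine ⟨y ∘ β.symm, fun e => ?_⟩
    rw [← key]
    have h : ∑ j, C (ε (ε.symm e)) (σ j) • x (σ j) +
        ∑ k : Fin (Fintype.card B), D (ε (ε.symm e)) (β k) • y k = 0 := hy (ε.symm e)
    rw [ε.apply_symm_apply] at h
    simpa using h
  · rintro ⟨y, hy⟩
    exact ⟨y ∘ β, fun i => (key (ε i) y).trans (hy _)⟩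

theorem IsSolvable.map {E J B : Type} [Fintype J] [Fintype B] {C : Matrix E J R}
    {D : Matrix E B R} {N : Type v} [AddCommGroup N] [Module R N] {P : Type w} [AddCommGroup P]
    [Module R P] (g : N →ₗ[R] P) {x : J → N} (h : IsSolvable C D x) :
    IsSolvable C D (g ∘ x) := by
  obtain ⟨y, hy⟩ := h
  refine ⟨g ∘ y, fun e => ?_⟩
  simpa [map_add, map_sum] using congrArg g (hy e)

theorem IsSolvable.sub {E J B : Type} [Fintype J] [Fintype B] {C : Matrix E J R}
    {D : Matrix E B R} {N : Type v} [AddCommGroup N] [Module R N] {x x' : J → N}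
    (h : IsSolvable C D x) (h' : IsSolvable C D x') : IsSolvable C D (x - x') := by
  obtain ⟨y, hy⟩ := h
  obtain ⟨y', hy'⟩ := h'
  refine ⟨y - y', fun e => ?_⟩
  have h := congrArg₂ (· - ·) (hy e) (hy' e)
  simp only [sub_zero] at h
  rw [← h]
  simp only [Pi.sub_apply, smul_sub, Finset.sum_sub_distrib]
  abel

theorem IsSolvable.add {E J B : Type} [Fintype J] [Fintype B] {C : Matrix E J R}
    {D : Matrix E B R} {N : Type v} [AddCommGroup N] [Module R N] {x x' : J → N}
    (h : IsSolvable C D x) (h' : IsSolvable C D x') : IsSolvable C D (x + x') := by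
  obtain ⟨y, hy⟩ := h
  obtain ⟨y', hy'⟩ := h'
  refine ⟨y + y', fun e => ?_⟩
  have h := congrArg₂ (· + ·) (hy e) (hy' e)
  simp only [add_zero] at h
  rw [← h]
  simp only [Pi.add_apply, smul_add, Finset.sum_add_distrib]
  abel

theorem isSolvable_zero {E J B : Type} [Fintype J] [Fintype B] (C : Matrix E J R)
    (D : Matrix E B R) (N : Type v) [AddCommGroup N] [Module R N] :
    IsSolvable C D (0 : J → N) :=
  ⟨0, by simp⟩

/-- Pp-conditions are computed componentwise in direct powers. -/
theorem isSolvable_pi_iff {E J B : Type} [Fintype J] [Fintype B] {C : Matrix E J R}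
    {D : Matrix E B R} {N : Type v} [AddCommGroup N] [Module R N] {I : Type w}
    {x : J → I → N} : IsSolvable C D x ↔ ∀ i, IsSolvable C D fun j => x j i := by
  constructor
  · intro h i
    exact h.map (LinearMap.proj (φ := fun _ : I => N) i)
  · intro h
    choose y hy using h
    refine ⟨fun b i => y i b, fun e => ?_⟩
    ext i
    simpa using hy i e

/-- Pp-conditions are computed componentwise in direct sums. -/
theorem isSolvable_finsupp_iff {E J B : Type} [Fintype J] [Fintype B] {C : Matrix E J R}
    {D : Matrix E B R} {N : Type v} [AddCommGroup N] [Module R N] {I : Type w}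
    {x : J → I →₀ N} : IsSolvable C D x ↔ ∀ i, IsSolvable C D fun j => x j i := by
  classical
  constructor
  · intro h i
    exact h.map (Finsupp.lapply i)
  · intro h
    choose y hy using h
    let F : Finset I := Finset.univ.biUnion fun j => (x j).support
    have hF : ∀ i, i ∉ F → ∀ j, x j i = 0 := by
      intro i hi j
      by_contra h0
      exact hi (Finset.mem_biUnion.2 ⟨j, Finset.mem_univ j, Finsupp.mem_support_iff.2 h0⟩)
    -- Off the supports of the free variables the witnesses are replaced by zero, which makes them
    -- finitely supported.
    refine ⟨fun b => Finsupp.indicator F fun i _ => y i b, fun e => ?_⟩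
    ext i
    by_cases hi : i ∈ F
    · simpa [Finsupp.finsetSum_apply, hi] using hy i e
    · simp [hi, hF i hi]

open Classical in
/-- The coefficients of a pp-condition after renaming its free variables along `τ`. -/
noncomputable def renameCoeff {E J J' : Type} [Fintype J] (C : Matrix E J R) (τ : J → J') :
    Matrix E J' R :=
  fun e j' => ∑ j, if τ j = j' then C e j else 0

theorem isSolvable_renameCoeff_iff {E J J' B : Type} [Fintype J] [Fintype J'] [Fintype B]
    (C : Matrix E J R) (D : Matrix E B R) (τ : J → J') {N : Type v} [AddCommGroup N] [Module R N]
    (x : J' → N) : IsSolvable (renameCoeff C τ) D x ↔ IsSolvable C D (x ∘ τ) := by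
  classical
  have key : ∀ e, ∑ j', renameCoeff C τ e j' • x j' = ∑ j, C e j • (x ∘ τ) j := fun e => by
    simp only [renameCoeff, Finset.sum_smul, ite_smul, zero_smul]
    rw [Finset.sum_comm]
    simp
  simp only [IsSolvable, key]

theorem isSolvable_fromRows_iff {E E' J B B' : Type} [Fintype J] [Fintype B] [Fintype B']
    (C : Matrix E J R) (D : Matrix E B R) (C' : Matrix E' J R) (D' : Matrix E' B' R)
    {N : Type v} [AddCommGroup N] [Module R N] (x : J → N) :
    IsSolvable (Matrix.fromRows C C') (Matrix.fromBlocks D 0 0 D') x ↔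
      IsSolvable C D x ∧ IsSolvable C' D' x := by
  constructor
  · rintro ⟨y, hy⟩
    exact ⟨⟨y ∘ Sum.inl, fun e => by simpa using hy (Sum.inl e)⟩,
      ⟨y ∘ Sum.inr, fun e => by simpa using hy (Sum.inr e)⟩⟩
  · rintro ⟨⟨y, hy⟩, ⟨y', hy'⟩⟩
    refine ⟨Sum.elim y y', fun e => ?_⟩
    rcases e with e | e
    · simpa using hy e
    · simpa using hy' e

/-- The conjunction of two pp-conditions which share their first free variable. -/
theorem isSolvable_amalgam_iff {E E' J J' B B' : Type} [Fintype J] [Fintype J'] [Fintype B]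
    [Fintype B'] (C : Matrix E (Unit ⊕ J) R) (D : Matrix E B R) (C' : Matrix E' (Unit ⊕ J') R)
    (D' : Matrix E' B' R) {N : Type v} [AddCommGroup N] [Module R N] (x : Unit → N) (w : J → N)
    (w' : J' → N) :
    IsSolvable (Matrix.fromRows (renameCoeff C (Sum.map id Sum.inl : _ → Unit ⊕ (J ⊕ J')))
      (renameCoeff C' (Sum.map id Sum.inr))) (Matrix.fromBlocks D 0 0 D')
        (Sum.elim x (Sum.elim w w')) ↔
      IsSolvable C D (Sum.elim x w) ∧ IsSolvable C' D' (Sum.elim x w') := by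
  rw [isSolvable_fromRows_iff, isSolvable_renameCoeff_iff, isSolvable_renameCoeff_iff,
    Sum.elim_comp_map, Sum.elim_comp_map, Sum.elim_comp_inl, Sum.elim_comp_inr, Function.comp_id]

/-- A free variable of a pp-condition may be quantified. -/
theorem isSolvable_fromCols_iff {E J B : Type} [Fintype J] [Fintype B]
    (C : Matrix E (Unit ⊕ J) R) (D : Matrix E B R) {N : Type v} [AddCommGroup N] [Module R N]
    (w : J → N) : IsSolvable C.toCols₂ (Matrix.fromCols C.toCols₁ D) w ↔
      ∃ x, IsSolvable C D (Sum.elim (fun _ => x) w) := by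
  constructor
  · rintro ⟨y, hy⟩
    refine ⟨y (Sum.inl ()), y ∘ Sum.inr, fun e => ?_⟩
    rw [← hy e]
    simp
    abel
  · rintro ⟨x, y, hy⟩
    refine ⟨Sum.elim (fun _ => x) y, fun e => ?_⟩
    rw [← hy e]
    simp
    abel

/-- Setting the parameters to zero gives the pp-subgroup of which the solution set with parameters
is a coset, if nonempty. In this way the chain condition controls conditions with parameters. -/
theorem isSolvable_elim_zero_iff {E J B : Type} [Fintype J] [Fintype B]
    (C : Matrix E (Unit ⊕ J) R) (D : Matrix E B R) {N : Type v} [AddCommGroup N] [Module R N]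
    (x : Unit → N) : IsSolvable C D (Sum.elim x 0) ↔ IsSolvable C.toCols₁ D x := by
  simp [IsSolvable]

end Systems

/-! ### The descending chain condition implies pure-injectivity -/

section DescendingChains

variable {R : Type u} [Ring R]

/-- The subgroup of `N` defined by a pp-formula in one variable. -/
def PPFormula.subgroup (ψ : PPFormula R 1) (N : Type v) [AddCommGroup N] [Module R N] :
    AddSubgroup N where
  carrier := {x | ψ.Realize fun _ => x}
  zero_mem' := isSolvable_zero _ _ N
  add_mem' := fun h h' => IsSolvable.add h h'
  neg_mem' := fun {x} h => by
    have h' := IsSolvable.sub (isSolvable_zero ψ.freeCoeff ψ.boundCoeff N) h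
    have h0 : (0 : Fin 1 → N) - (fun _ => x) = fun _ => -x := by ext; simp
    rw [h0] at h'
    exact h'

theorem PPFormula.map_mem_subgroup {ψ : PPFormula R 1} {N : Type v} [AddCommGroup N] [Module R N]
    {P : Type w} [AddCommGroup P] [Module R P] (g : N →ₗ[R] P) {x : N} (h : x ∈ ψ.subgroup N) :
    g x ∈ ψ.subgroup P :=
  IsSolvable.map g h

theorem PPFormula.mem_subgroup_pi {ψ : PPFormula R 1} {N : Type v} [AddCommGroup N] [Module R N]
    {I : Type w} {x : I → N} : x ∈ ψ.subgroup (I → N) ↔ ∀ i, x i ∈ ψ.subgroup N :=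
  isSolvable_pi_iff

theorem PPFormula.mem_subgroup_finsupp {ψ : PPFormula R 1} {N : Type v} [AddCommGroup N]
    [Module R N] {I : Type w} {x : I →₀ N} :
    x ∈ ψ.subgroup (I →₀ N) ↔ ∀ i, x i ∈ ψ.subgroup N :=
  isSolvable_finsupp_iff

theorem PPFormula.subgroup_finsupp_le_iff {ψ ψ' : PPFormula R 1} {N : Type v} [AddCommGroup N]
    [Module R N] {I : Type w} [Nonempty I] :
    ψ.subgroup (I →₀ N) ≤ ψ'.subgroup (I →₀ N) ↔ ψ.subgroup N ≤ ψ'.subgroup N := by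
  constructor
  · intro h x hx
    let i : I := Classical.arbitrary I
    have h' := mem_subgroup_finsupp.1 (h (map_mem_subgroup (Finsupp.lsingle (R := R) i) hx)) i
    simpa using h'
  · intro h x hx
    rw [mem_subgroup_finsupp] at hx ⊢
    exact fun i => h (hx i)

variable (R) in
/-- The descending chain condition on pp-definable subgroups. -/
def HasPPDescendingChainCondition (N : Type v) [AddCommGroup N] [Module R N] : Prop :=
  WellFounded fun ψ ψ' : PPFormula R 1 => ψ.subgroup N < ψ'.subgroup N

theorem HasPPDescendingChainCondition.finsupp {N : Type v} [AddCommGroup N] [Module R N]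
    (h : HasPPDescendingChainCondition R N) (I : Type w) [Nonempty I] :
    HasPPDescendingChainCondition R (I →₀ N) := by
  simpa only [HasPPDescendingChainCondition, lt_iff_le_not_ge,
    PPFormula.subgroup_finsupp_le_iff] using h

/-- `G` preserves finite pp-conditions from the first to the second component. -/
def PreservesSolvability (R : Type u) [Ring R] {N : Type v} {A : Type w} [AddCommGroup N]
    [Module R N] [AddCommGroup A] [Module R A] (G : Set (N × A)) : Prop :=
  ∀ (E J B : Type) [Fintype E] [Fintype J] [Fintype B] (C : Matrix E J R) (D : Matrix E B R)
    (z : J → N × A), (∀ j, z j ∈ G) → IsSolvable C D (fun j => (z j).1) →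
      IsSolvable C D fun j => (z j).2

variable {N : Type v} {A : Type w} [AddCommGroup N] [Module R N] [AddCommGroup A] [Module R A]

/-- Purity makes the inverse graph of `f` a starting point for the Zorn argument. -/
theorem IsPureEmbedding.preservesSolvability {f : A →ₗ[R] N} (hf : IsPureEmbedding f) :
    PreservesSolvability R (Set.range fun a => (f a, a)) := by
  intro E J B _ _ _ C D z hz h
  choose a ha using hz
  have hz : z = fun j => (f (a j), a j) := funext fun j => (ha j).symm
  subst hz
  let σ := (Fintype.equivFin J).symm
  refine (PPFormula.realize_ofSystem C D σ a).1 ?_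
  rw [hf.2]
  exact (PPFormula.realize_ofSystem C D σ fun j => f (a j)).2 h

theorem PreservesSolvability.sUnion {c : Set (Set (N × A))}
    (hc : ∀ G ∈ c, PreservesSolvability R G) (hchain : IsChain (· ⊆ ·) c) (hne : c.Nonempty) :
    PreservesSolvability R (⋃₀ c) := by
  intro E J B _ _ _ C D z hz h
  obtain ⟨G, hG, hsub⟩ := DirectedOn.exists_mem_subset_of_finite_of_subset_sUnion hne
    hchain.directedOn (Set.finite_range z) (by rintro _ ⟨j, rfl⟩; exact hz j)
  exact hc G hG E J B C D z (fun j => hsub ⟨j, rfl⟩) h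

/-- The descending chain condition allows to realize in `A` the pp-type of an element `x` over the
first components of a relation which preserves pp-conditions. -/
theorem PreservesSolvability.exists_insert {G : Set (N × A)} (hG : PreservesSolvability R G)
    (hne : G.Nonempty) (hA : HasPPDescendingChainCondition R A) (x : N) :
    ∃ a, PreservesSolvability R (insert (x, a) G) := by
  classical
  -- `ψ` is the homogeneous part of a condition satisfied by `x` with parameters from `G`, and `a`
  -- solves the transferred condition. A minimal such subgroup determines the element to be paired
  -- with `x`.
  let P : PPFormula R 1 → A → Prop := fun ψ a =>
    ∃ (E J B : Type) (_ : Fintype E) (_ : Fintype J) (_ : Fintype B)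
      (C : Matrix E (Unit ⊕ J) R) (D : Matrix E B R) (z : J → N × A),
      (∀ j, z j ∈ G) ∧ IsSolvable C D (Sum.elim (fun _ => x) fun j => (z j).1) ∧
      IsSolvable C D (Sum.elim (fun _ => a) fun j => (z j).2) ∧
      ψ = PPFormula.ofSystem C.toCols₁ D (Equiv.ofUnique (Fin 1) Unit)
  have hP : ∀ {E J B : Type} [Fintype E] [Fintype J] [Fintype B]
      (C : Matrix E (Unit ⊕ J) R) (D : Matrix E B R) (z : J → N × A),
      (∀ j, z j ∈ G) → IsSolvable C D (Sum.elim (fun _ => x) fun j => (z j).1) →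
      ∃ a, IsSolvable C D (Sum.elim (fun _ => a) fun j => (z j).2) := by
    intro E J B _ _ _ C D z hz h
    exact (isSolvable_fromCols_iff C D _).1
      (hG _ _ _ _ _ z hz ((isSolvable_fromCols_iff C D _).2 ⟨x, h⟩))
  have hmem : ∀ {E J B : Type} [Fintype E] [Fintype J] [Fintype B]
      (C : Matrix E (Unit ⊕ J) R) (D : Matrix E B R) (a : A),
      a ∈ (PPFormula.ofSystem C.toCols₁ D (Equiv.ofUnique (Fin 1) Unit)).subgroup A ↔
        IsSolvable C D (Sum.elim (fun _ => a) 0) := by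
    intro E J B _ _ _ C D a
    rw [isSolvable_elim_zero_iff]
    exact PPFormula.realize_ofSystem C.toCols₁ D (Equiv.ofUnique (Fin 1) Unit) fun _ => a
  obtain ⟨ψ, ⟨a, E, J, B, _, _, _, C, D, z, hz, hx, ha, rfl⟩, hmin⟩ :=
    hA.has_min {ψ | ∃ a, P ψ a} (by
      have h : IsSolvable (0 : Matrix Empty (Unit ⊕ Empty) R) (0 : Matrix Empty Empty R)
        (Sum.elim (fun _ => x) fun j : Empty => (j.elim : N × A).1) := ⟨0, fun e => e.elim⟩
      exact ⟨_, 0, Empty, Empty, Empty, inferInstance, inferInstance, inferInstance, 0, 0,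
        fun j => j.elim, fun j => j.elim, h, ⟨0, fun e => e.elim⟩, rfl⟩)
  have key : ∀ {E' J' B' : Type} [Fintype E'] [Fintype J'] [Fintype B']
      (C' : Matrix E' (Unit ⊕ J') R) (D' : Matrix E' B' R) (z' : J' → N × A),
      (∀ j, z' j ∈ G) → IsSolvable C' D' (Sum.elim (fun _ => x) fun j => (z' j).1) →
      IsSolvable C' D' (Sum.elim (fun _ => a) fun j => (z' j).2) := by
    -- Let `b` solve the conjunction with the minimal condition. By minimality the conjunction has
    -- the same homogeneous part, which contains `a - b`; adding `b` back shows that `a` satisfies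
    -- the new condition.
    intro E' J' B' _ _ _ C' D' z' hz' hx'
    let C₁ : Matrix (E ⊕ E') (Unit ⊕ (J ⊕ J')) R :=
      Matrix.fromRows (renameCoeff C (Sum.map id Sum.inl)) (renameCoeff C' (Sum.map id Sum.inr))
    let D₁ : Matrix (E ⊕ E') (B ⊕ B') R := Matrix.fromBlocks D 0 0 D'
    have hz₁ : ∀ j, Sum.elim z z' j ∈ G := fun j => by
      rcases j with j | j
      · exact hz j
      · exact hz' j
    have hfst : (fun j => (Sum.elim z z' j).1) =
        Sum.elim (fun j => (z j).1) fun j => (z' j).1 := by ext j; rcases j with j | j <;> rfl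
    have hsnd : (fun j => (Sum.elim z z' j).2) =
        Sum.elim (fun j => (z j).2) fun j => (z' j).2 := by ext j; rcases j with j | j <;> rfl
    have hx₁ : IsSolvable C₁ D₁ (Sum.elim (fun _ => x) fun j => (Sum.elim z z' j).1) := by
      rw [hfst]
      exact (isSolvable_amalgam_iff C D C' D' _ _ _).2 ⟨hx, hx'⟩
    obtain ⟨b, hb⟩ := hP C₁ D₁ (Sum.elim z z') hz₁ hx₁
    have hmin₁ := hmin _ ⟨b, _, _, _, inferInstance, inferInstance, inferInstance, C₁, D₁, _, hz₁,
      hx₁, hb, rfl⟩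
    rw [hsnd] at hb
    obtain ⟨hb, hb'⟩ := (isSolvable_amalgam_iff C D C' D' _ _ _).1 hb
    have hzero : ∀ c : A, IsSolvable C₁ D₁ (Sum.elim (fun _ => c) 0) ↔
        IsSolvable C D (Sum.elim (fun _ => c) 0) ∧
          IsSolvable C' D' (Sum.elim (fun _ => c) 0) := fun c => by
      rw [← isSolvable_amalgam_iff C D C' D', Sum.elim_zero_zero]
    have hle : (PPFormula.ofSystem C₁.toCols₁ D₁ (Equiv.ofUnique (Fin 1) Unit)).subgroup A ≤
        (PPFormula.ofSystem C.toCols₁ D (Equiv.ofUnique (Fin 1) Unit)).subgroup A := fun c hc => by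
      rw [hmem, hzero] at hc
      exact (hmem C D c).2 hc.1
    have hab : a - b ∈ (PPFormula.ofSystem C.toCols₁ D
        (Equiv.ofUnique (Fin 1) Unit)).subgroup A := by
      rw [hmem]
      convert ha.sub hb using 1
      ext i
      rcases i with i | i <;> simp
    rw [← eq_of_le_of_not_lt hle hmin₁, hmem, hzero] at hab
    convert hab.2.add hb' using 1
    ext i
    rcases i with i | i <;> simp
  refine ⟨a, fun E' J' B' _ _ _ C' D' z' hz' h => ?_⟩
  obtain ⟨g, hg⟩ := hne
  -- All variables assigned the new pair `(x, a)` and not a pair in `G` are merged into one; their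
  -- vacated places receive the dummy parameter `g`.
  let τ : J' → Unit ⊕ J' := fun j => if z' j ∈ G then Sum.inr j else Sum.inl ()
  let w : J' → N × A := fun j => if z' j ∈ G then z' j else g
  have hw : ∀ j, w j ∈ G := fun j => by
    by_cases hj : z' j ∈ G <;> simp [w, hj, hg]
  have hτ : ∀ j, z' j = Sum.elim (fun _ : Unit => (x, a)) w (τ j) := fun j => by
    by_cases hj : z' j ∈ G
    · simp [τ, w, hj]
    · simpa [τ, hj] using (hz' j).resolve_right hj
  have hfst : (fun j => (z' j).1) = Sum.elim (fun _ => x) (fun j => (w j).1) ∘ τ := by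
    ext j
    rw [hτ j, Function.comp_apply]
    rcases τ j with i | i <;> rfl
  have hsnd : (fun j => (z' j).2) = Sum.elim (fun _ => a) (fun j => (w j).2) ∘ τ := by
    ext j
    rw [hτ j, Function.comp_apply]
    rcases τ j with i | i <;> rfl
  rw [hfst, ← isSolvable_renameCoeff_iff] at h
  rw [hsnd, ← isSolvable_renameCoeff_iff]
  exact key _ _ w hw h

/-- A total relation which preserves pp-conditions is the graph of a linear map. -/
theorem PreservesSolvability.exists_linearMap {G : Set (N × A)} (hG : PreservesSolvability R G)
    (htotal : ∀ x, ∃ a, (x, a) ∈ G) : ∃ p : N →ₗ[R] A, ∀ x a, (x, a) ∈ G → p x = a := by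
  choose p hp using htotal
  -- A linear relation is a pp-condition with one equation and no bound variables.
  have hlin : ∀ {n : ℕ} (c : Fin n → R) (z : Fin n → N × A), (∀ j, z j ∈ G) →
      ∑ j, c j • (z j).1 = 0 → ∑ j, c j • (z j).2 = 0 := by
    intro n c z hz h
    obtain ⟨_, hy⟩ := hG Unit (Fin n) Empty (fun _ => c) 0 z hz ⟨0, by simpa using h⟩
    simpa using hy ()
  have huniq : ∀ x a, (x, a) ∈ G → p x = a := by
    intro x a ha
    have h := hlin ![1, -1] ![(x, p x), (x, a)] (by simp [Fin.forall_fin_two, hp, ha])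
      (by simp [Fin.sum_univ_two])
    simpa [Fin.sum_univ_two, ← sub_eq_add_neg, sub_eq_zero] using h
  refine ⟨⟨⟨p, fun x y => ?_⟩, fun r x => ?_⟩, huniq⟩
  · have h := hlin ![1, -1, -1] ![(x + y, p (x + y)), (x, p x), (y, p y)]
      (by simp [Fin.forall_fin_succ, hp]) (by simp [Fin.sum_univ_three])
    simp only [Fin.sum_univ_three, Matrix.cons_val_zero, Matrix.cons_val_one, Matrix.cons_val,
      one_smul, neg_smul] at h
    rw [← sub_eq_zero, ← h]
    abel
  · have h := hlin ![1, -r] ![(r • x, p (r • x)), (x, p x)]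
      (by simp [Fin.forall_fin_two, hp]) (by simp [Fin.sum_univ_two])
    simpa [Fin.sum_univ_two, ← sub_eq_add_neg, sub_eq_zero] using h

/-- Modules with the descending chain condition on pp-definable subgroups are pure-injective. -/
theorem HasPPDescendingChainCondition.exists_retraction (hA : HasPPDescendingChainCondition R A)
    {f : A →ₗ[R] N} (hf : IsPureEmbedding f) : ∃ p : N →ₗ[R] A, p ∘ₗ f = LinearMap.id := by
  obtain ⟨G, hfG, hmax⟩ := zorn_subset_nonempty {G : Set (N × A) | PreservesSolvability R G}
    (fun c hc hchain hne => ⟨⋃₀ c, PreservesSolvability.sUnion hc hchain hne,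
      fun s hs => Set.subset_sUnion_of_mem hs⟩) _ hf.preservesSolvability
  have hG : PreservesSolvability R G := hmax.prop
  obtain ⟨p, hp⟩ := hG.exists_linearMap fun x => by
    obtain ⟨a, ha⟩ := hG.exists_insert ⟨_, hfG ⟨0, rfl⟩⟩ hA x
    exact ⟨a, hmax.le_of_ge ha (Set.subset_insert _ _) (Set.mem_insert _ _)⟩
  exact ⟨p, LinearMap.ext fun a => hp _ _ (hfG ⟨a, rfl⟩)⟩

theorem HasPPDescendingChainCondition.isSigmaAlgebraicallyCompact
    (hA : HasPPDescendingChainCondition R A) : IsSigmaAlgebraicallyCompact R A :=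
  fun I _ _ _ _ _ hf => (hA.finsupp I).exists_retraction hf

end DescendingChains


/-! ### Direct summands of sums and powers -/

section Summands

variable {R : Type u} [Ring R] {M : Type v} [AddCommGroup M] [Module R M]

theorem isIsoToDirectSummand_of_comp_eq_id {N : Type v} {P : Type w} [AddCommGroup N] [Module R N]
    [AddCommGroup P] [Module R P] (i : N →ₗ[R] P) (p : P →ₗ[R] N) (h : p ∘ₗ i = LinearMap.id) :
    IsIsoToDirectSummand R N P := by
  have hpi : ∀ x, p (i x) = x := LinearMap.congr_fun h
  refine ⟨LinearMap.range i, ⟨LinearMap.ker p, ?_⟩,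
    ⟨LinearEquiv.ofInjective i (Function.LeftInverse.injective hpi)⟩⟩
  refine ⟨Submodule.disjoint_def.2 ?_, Submodule.codisjoint_iff_exists_add_eq.2 fun z =>
    ⟨i (p z), z - i (p z), ⟨_, rfl⟩, ?_, add_sub_cancel _ _⟩⟩
  · rintro _ ⟨x, rfl⟩ hx
    rw [LinearMap.mem_ker, hpi] at hx
    rw [hx, map_zero]
  · rw [LinearMap.mem_ker, map_sub, hpi, sub_self]

theorem IsIsoToDirectSummand.exists_comp_eq_id {N : Type v} {P : Type w} [AddCommGroup N]
    [Module R N] [AddCommGroup P] [Module R P] (h : IsIsoToDirectSummand R N P) :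
    ∃ (i : N →ₗ[R] P) (p : P →ₗ[R] N), p ∘ₗ i = LinearMap.id := by
  obtain ⟨K, hK, ⟨e⟩⟩ := h
  obtain ⟨L, hL⟩ := hK
  refine ⟨K.subtype ∘ₗ e, e.symm ∘ₗ K.projectionOnto L hL, LinearMap.ext fun x => ?_⟩
  simp

theorem IsIsoToDirectSummand.trans_comp_eq_id {N : Type v} {P Q : Type w} [AddCommGroup N]
    [Module R N] [AddCommGroup P] [Module R P] [AddCommGroup Q] [Module R Q]
    (h : IsIsoToDirectSummand R N P) (i : P →ₗ[R] Q) (p : Q →ₗ[R] P)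
    (hpi : p ∘ₗ i = LinearMap.id) : IsIsoToDirectSummand R N Q := by
  obtain ⟨i', p', h'⟩ := h.exists_comp_eq_id
  refine isIsoToDirectSummand_of_comp_eq_id (i ∘ₗ i') (p' ∘ₗ p) ?_
  rw [LinearMap.comp_assoc, ← LinearMap.comp_assoc i' i p, hpi, LinearMap.id_comp, h']

/-- Direct sums are pure in direct powers. -/
theorem isPureEmbedding_lcoeFun (I : Type w) :
    IsPureEmbedding (Finsupp.lcoeFun : (I →₀ M) →ₗ[R] I → M) := by
  refine ⟨DFunLike.coe_injective, fun n ψ x => ?_⟩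
  rw [PPFormula.realize_iff_isSolvable, PPFormula.realize_iff_isSolvable, isSolvable_finsupp_iff,
    isSolvable_pi_iff]
  rfl

theorem IsSigmaAlgebraicallyCompact.add_subset_prod (h : IsSigmaAlgebraicallyCompact R M) :
    Add R M ⊆ Prod R M := by
  rintro N ⟨I, hN⟩
  refine ⟨I, ?_⟩
  cases finite_or_infinite I with
  | inl _ =>
    exact hN.trans_comp_eq_id (Finsupp.linearEquivFunOnFinite R M I).toLinearMap
      (Finsupp.linearEquivFunOnFinite R M I).symm.toLinearMap (by ext; simp)
  | inr _ =>
    obtain ⟨p, hp⟩ := h I (I → M) Finsupp.lcoeFun (isPureEmbedding_lcoeFun I)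
    exact hN.trans_comp_eq_id _ p hp

theorem hasPPDescendingChainCondition_of_add_subset_prod
    (hM : ¬ IsOmegaMeasurable (Cardinal.mk M)) (h : Add R M ⊆ Prod R M) :
    HasPPDescendingChainCondition R M := by
  by_contra hdcc
  obtain ⟨ψ, hψ⟩ : ∃ ψ : ℕ → PPFormula R 1, ∀ n, (ψ (n + 1)).subgroup M < (ψ n).subgroup M := by
    rw [HasPPDescendingChainCondition, wellFounded_iff_isEmpty_descending_chain,
      not_isEmpty_iff] at hdcc
    exact ⟨hdcc.some.1, hdcc.some.2⟩
  let H : ℕ → AddSubgroup M := fun n => (ψ n).subgroup M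
  have hH : Antitone H := antitone_nat_of_succ_le fun n => (hψ n).le
  -- The summand `ℕ` keeps the bound `κ` infinite when `M` is finite, and Cantor's theorem makes `Λ`
  -- larger than `κ`.
  let Λ : Type (max u v) := ULift.{max u v} (Set (ℕ ⊕ M))
  let κ : Cardinal.{max u v} := Cardinal.lift.{max u v} (Cardinal.mk (ℕ ⊕ M))
  have hκ : Cardinal.aleph0 ≤ κ := Cardinal.aleph0_le_lift.2 (Cardinal.aleph0_le_mk _)
  have hMκ : Cardinal.lift.{max u v} (Cardinal.mk M) ≤ Cardinal.lift.{v} κ := by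
    simp [κ]
  have hκΛ : κ < Cardinal.mk Λ := by
    rw [Cardinal.mk_uLift, Cardinal.lift_lt, Cardinal.mk_set]
    exact Cardinal.cantor _
  have hΛ : ModuleCat.of R (Λ →₀ M) ∈ Add R M :=
    ⟨Λ, isIsoToDirectSummand_of_comp_eq_id LinearMap.id LinearMap.id rfl⟩
  obtain ⟨I, hI⟩ := h hΛ
  obtain ⟨i, p, hpi⟩ : ∃ (i : (Λ →₀ M) →ₗ[R] I → M) (p : (I → M) →ₗ[R] Λ →₀ M),
    p ∘ₗ i = LinearMap.id := hI.exists_comp_eq_id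
  obtain ⟨n, J, hJ, hbound⟩ := isCardinalBoundedOn_univ (f := p.toAddMonoidHom) hH
    (fun n a ha j => PPFormula.mem_subgroup_finsupp.1
      (PPFormula.map_mem_subgroup p (PPFormula.mem_subgroup_pi.2 ha)) j) hM hκ hMκ
  obtain ⟨j, hj⟩ : ∃ j, j ∉ J := by
    by_contra! hall
    rw [Set.eq_univ_of_forall hall, Cardinal.mk_univ] at hJ
    exact hJ.not_gt hκΛ
  -- Since `p ∘ i` is the identity, the copy of `H n` at `j ∉ J` is fixed, and the bound puts its
  -- elements in `H (n + 1)`.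
  refine (hψ n).not_ge fun m hm => ?_
  have him : i (Finsupp.single j m) ∈ (ψ n).subgroup (I → M) :=
    PPFormula.map_mem_subgroup (i ∘ₗ Finsupp.lsingle j) hm
  have hmj := hbound _ (PPFormula.mem_subgroup_pi.1 him) (fun k hk => absurd (Set.mem_univ k) hk)
    j hj (n + 1)
  have hpim : p (i (Finsupp.single j m)) = Finsupp.single j m := LinearMap.congr_fun hpi _
  simpa [hpim] using hmj

end Summands

end PureModules

theorem theorem4p3 {R : Type u} [Ring R] {M : Type v} [AddCommGroup M] [Module R M]
    (hM : ¬ PureModules.IsOmegaMeasurable (Cardinal.mk M)) :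
    PureModules.Add R M ⊆ PureModules.Prod R M ↔
      PureModules.IsSigmaAlgebraicallyCompact R M :=
  ⟨fun h => (PureModules.hasPPDescendingChainCondition_of_add_subset_prod
    hM h).isSigmaAlgebraicallyCompact,
    fun h => h.add_subset_prod⟩
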